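/- Let $G$ be a finite simple graph. An $\ell$-vertex-ranking of $G$ is a colouring of $V(G)$ by positive integers such that every connected subgraph $H$ of $G$ of diameter at most $\ell$ contains a vertex whose colour is larger than that of every other vertex of $H$. Let $\mathrm{rn}_\ell(G)$ be the least integer $k$ such that $G$ has an $\ell$-vertex-ranking $\varphi:V(G)\to\{1,\ldots,k\}$. The graph $G$ is $d$-degenerate if every non-empty induced subgraph of $G$ has a vertex of degree at most $d$. Theorem. For all integers $d\ge 1$ and $\ell\ge 2$ there exists a constant $c=c(d,\ell)$ such that, for every integer $n\ge 2$, every $n$-vertex $d$-degenerate graph $G$ satisfies \[ \mathrm{rn}_\ell(G)\le c\,n^{1-\frac{1}{\lfloor \ell/2\rfloor+1/2}}\log n=\begin{cases} c\,n^{1-2/\ell}\log n & \text{if $\ell$ is odd,}\\ c\,n^{1-2/(\ell+1)}\log n & \text{if $\ell$ is even.}\end{cases} \] -/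

import Mathlib

namespace SimpleGraph

/-- `G` is `d`-degenerate: every induced subgraph on a nonempty finite vertex set `S` has a vertex
of degree at most `d`. -/
def IsDegenerate {V : Type*} (G : SimpleGraph V) (d : ℕ) : Prop :=
  ∀ S : Finset V, S.Nonempty → ∃ v ∈ S, {w | w ∈ S ∧ G.Adj v w}.ncard ≤ d

/-- `φ` is an `ℓ`-vertex-ranking of `G`: every connected subgraph `H` of `G` of diameter (measured
inside `H`) at most `ℓ` has a vertex whose colour is larger than that of every other vertex
of `H`. -/
def IsVertexRanking {V : Type*} (G : SimpleGraph V) (ℓ : ℕ) (φ : V → ℕ) : Prop :=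
  ∀ H : G.Subgraph, H.Connected → H.coe.ediam ≤ (ℓ : ℕ∞) →
    ∃ v ∈ H.verts, ∀ w ∈ H.verts, w ≠ v → φ w < φ v

/-- The `ℓ`-vertex-ranking number of `G`: the least `k` such that `G` has an `ℓ`-vertex-ranking
with colours in `{1, …, k}`. Such a `k` exists for every finite graph, as shown below. -/
noncomputable def vertexRankingNumber {V : Type*} (G : SimpleGraph V) (ℓ : ℕ) : ℕ :=
  sInf {k : ℕ | ∃ φ : V → ℕ, (∀ v, φ v ∈ Set.Icc 1 k) ∧ G.IsVertexRanking ℓ φ}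

/-- On a finite graph the minimum defining `vertexRankingNumber` is over a nonempty set. -/
theorem exists_isVertexRanking {V : Type*} [Finite V] (G : SimpleGraph V) (ℓ : ℕ) :
    ∃ (k : ℕ) (φ : V → ℕ), (∀ v, φ v ∈ Set.Icc 1 k) ∧ G.IsVertexRanking ℓ φ := by
  classical
  obtain ⟨n, ⟨e⟩⟩ := Finite.exists_equiv_fin V
  refine ⟨n, fun v => (e v : ℕ) + 1, fun v => ⟨Nat.succ_pos _, (e v).2⟩, ?_⟩
  intro H hH _
  obtain ⟨v, hv, hmax⟩ := Set.exists_max_image H.verts (fun v => (e v : ℕ) + 1)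
    (Set.toFinite _) hH.nonempty
  refine ⟨v, hv, fun w hw hne => lt_of_le_of_ne (hmax w hw) fun h => hne ?_⟩
  exact e.injective (Fin.ext (by simpa using h))

end SimpleGraph

/-! ### From connected subgraphs to walks -/

namespace SimpleGraph

variable {V : Type*}

/-! Put `⌊ℓ/2⌋ = t + 1` and `s ≈ n^(1/(2t+3))`; the target is `O(s^(2t+1) log n)` colours.
Degeneracy gives `O(log n)` layers in which every vertex has `O(d)` neighbours not below it, so only
steps to lower layers branch widely. The set `Z` of vertices of degree above `s^2` has size
`O(n/s^2) = O(s^(2t+1))` and can afford private top colours; outside it a down-step has at most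
`s^2` choices. A walk of length at most `2t+3` has at most `t+1` down-steps in one of its two
directions. Separating all pairs joined by such walks would cost about `s^(2t+2)` colours, so one
factor `s` must be saved.

The saving has two stages. A greedy colouring of each layer with `O(s^(2t+1))` colours
(`exists_coloring_weight_le`) leaves few conflicts. Cutting a conflicting walk after its first
down-step exposes a bad vertex `x`, from which one end is reached upwards and the other with at most
`t` down-steps. The bad set `R` is recoloured above the layers. It is so small that its shadow `Y`,
the vertices reaching `R` upwards, has size `O(n/s)` (`exists_coloring_shadow_le`). A walk ending in
`R` enters `Y` by its last down-step. Only `O(n/s^2)` vertices have more than `s` down-neighbours in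
`Y`; they too get private colours, and then that last step has `s` choices instead of `s^2`
(`exists_coloring_avoiding_overloaded`). `isVertexRanking_of_colorings` assembles the tiers. -/

/-- A colouring is an `ℓ`-vertex-ranking as soon as every walk of length at most `ℓ` between
distinct vertices of the same colour passes through a vertex of larger colour. -/
theorem isVertexRanking_of_walk [Finite V] {G : SimpleGraph V} {ℓ : ℕ} {φ : V → ℕ}
    (h : ∀ (v w : V) (p : G.Walk v w), v ≠ w → φ v = φ w → p.length ≤ ℓ →
      ∃ x ∈ p.support, φ v < φ x) : G.IsVertexRanking ℓ φ := by
  intro H hH hd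
  obtain ⟨v, hv, hmax⟩ := Set.exists_max_image H.verts φ (Set.toFinite _) hH.nonempty
  refine ⟨v, hv, fun w hw hne => lt_of_le_of_ne (hmax w hw) fun heq => ?_⟩
  have hr : H.coe.Reachable ⟨v, hv⟩ ⟨w, hw⟩ := hH.coe.preconnected _ _
  obtain ⟨p, hp⟩ := hr.exists_walk_length_eq_edist
  have hlen : p.length ≤ ℓ := by
    have : (p.length : ℕ∞) ≤ ℓ := by
      rw [hp]; exact le_trans edist_le_ediam hd
    exact_mod_cast this
  obtain ⟨x, hx, hlt⟩ := h (H.hom ⟨v, hv⟩) (H.hom ⟨w, hw⟩) (p.map H.hom) hne.symm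
    heq.symm (by rw [Walk.length_map]; exact hlen)
  rw [Walk.support_map, List.mem_map] at hx
  obtain ⟨y, -, rfl⟩ := hx
  exact absurd (hmax _ y.2) (not_le.mpr hlt)

theorem vertexRankingNumber_le_of_isVertexRanking {G : SimpleGraph V} {ℓ k : ℕ} {φ : V → ℕ}
    (hk : ∀ v, φ v < k) (h : G.IsVertexRanking ℓ φ) : G.vertexRankingNumber ℓ ≤ k := by
  refine Nat.sInf_le ⟨fun v => φ v + 1, fun v => ⟨Nat.succ_pos _, hk v⟩, ?_⟩
  intro H hH hd
  obtain ⟨v, hv, hmax⟩ := h H hH hd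
  exact ⟨v, hv, fun w hw hne => Nat.succ_lt_succ (hmax w hw hne)⟩

/-! ### Degeneracy: degree sums and layers -/

section Degenerate

open Classical in
/-- In a `d`-degenerate graph, the degrees of the subgraph induced on `S` sum to at
most `2 d |S|`. -/
theorem IsDegenerate.sum_degree_le {G : SimpleGraph V} {d : ℕ} (hG : G.IsDegenerate d)
    (S : Finset V) : ∑ v ∈ S, (S.filter (G.Adj v)).card ≤ 2 * d * S.card := by
  induction hn : S.card generalizing S with
  | zero => simp [Finset.card_eq_zero.mp hn]
  | succ n ih =>
    obtain ⟨v, hv, hvd⟩ := hG S (Finset.card_pos.mp (by omega))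
    have hvd' : (S.filter (G.Adj v)).card ≤ d := by
      rw [← Set.ncard_coe_finset]
      simpa [Finset.coe_filter] using hvd
    have hcard : (S.erase v).card = n := by rw [Finset.card_erase_of_mem hv, hn]; rfl
    have ih' := ih (S.erase v) hcard
    -- Deleting `v` lowers the degree sum by twice the degree of `v`, hence by at most `2 d`.
    have hstep : ∀ u ∈ S.erase v, (S.filter (G.Adj u)).card =
        ((S.erase v).filter (G.Adj u)).card + if G.Adj v u then 1 else 0 := by
      intro u _
      rw [Finset.filter_erase, Finset.card_erase_eq_ite]
      by_cases hvu : G.Adj v u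
      · have hmem : v ∈ S.filter (G.Adj u) := Finset.mem_filter.mpr ⟨hv, hvu.symm⟩
        have := Finset.card_pos.mpr ⟨v, hmem⟩
        simp only [hmem, hvu, if_true]; omega
      · have hmem : v ∉ S.filter (G.Adj u) := fun h => hvu (Finset.mem_filter.mp h).2.symm
        simp [hmem, hvu]
    have hin : ∑ u ∈ S.erase v, (if G.Adj v u then 1 else 0) ≤ d := by
      rw [← Finset.card_filter]
      exact le_trans (Finset.card_le_card
        (Finset.filter_subset_filter _ (Finset.erase_subset _ _))) hvd'
    rw [← Finset.add_sum_erase _ _ hv, Finset.sum_congr rfl hstep, Finset.sum_add_distrib]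
    nlinarith

open Classical in
/-- Few vertices of a `d`-degenerate graph have degree larger than `D`. -/
theorem IsDegenerate.mul_card_degree_gt_le {G : SimpleGraph V} {d : ℕ} (hG : G.IsDegenerate d)
    (S : Finset V) (D : ℕ) :
    D * (S.filter fun v => D < (S.filter (G.Adj v)).card).card ≤ 2 * d * S.card := by
  refine le_trans ?_ (hG.sum_degree_le S)
  rw [mul_comm, ← smul_eq_mul]
  refine le_trans (Finset.card_nsmul_le_sum _ _ _ fun v hv =>
    ((Finset.mem_filter.mp hv).2).le) ?_
  exact Finset.sum_le_sum_of_subset (Finset.filter_subset _ _)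

open Classical in
/-- A `d`-degenerate graph on fewer than `2 ^ m` vertices splits into `m` layers such that every
vertex has at most `4 d` neighbours outside the lower layers. -/
theorem IsDegenerate.exists_layering {G : SimpleGraph V} {d : ℕ} (hd : 1 ≤ d)
    (hG : G.IsDegenerate d) (m : ℕ) (S : Finset V) (hS : S.card < 2 ^ m) :
    ∃ lam : V → ℕ, (∀ v ∈ S, lam v < m) ∧
      ∀ v ∈ S, (S.filter fun w => G.Adj v w ∧ lam v ≤ lam w).card ≤ 4 * d := by
  induction m generalizing S with
  | zero =>
    have : S = ∅ := Finset.card_eq_zero.mp (by simpa using hS)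
    exact ⟨fun _ => 0, by simp [this], by simp [this]⟩
  | succ m ih =>
    set B := S.filter fun v => 4 * d < (S.filter (G.Adj v)).card with hB
    have hBS : B ⊆ S := Finset.filter_subset _ _
    have hcard : B.card < 2 ^ m := by
      have h1 := hG.mul_card_degree_gt_le S (4 * d)
      rw [← hB] at h1
      -- The threshold `4 * d` is twice the average degree bound `2 * d`, so passing to `B` at least
      -- halves the set.
      have h2 : 2 * B.card ≤ S.card := by nlinarith
      rw [pow_succ] at hS
      omega
    obtain ⟨lam, h1, h2⟩ := ih B hcard
    refine ⟨fun v => if v ∈ B then lam v + 1 else 0, ?_, ?_⟩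
    · intro v _
      by_cases hv : v ∈ B
      · simpa [hv] using h1 v hv
      · simp [hv]
    · intro v hvS
      by_cases hv : v ∈ B
      · refine le_trans (Finset.card_le_card ?_) (h2 v hv)
        intro w hw
        simp only [Finset.mem_filter, hv, if_true] at hw ⊢
        by_cases hwB : w ∈ B
        · simp only [hwB, if_true] at hw
          exact ⟨hwB, hw.2.1, by omega⟩
        · simp [hwB] at hw
      · have h3 : (S.filter (G.Adj v)).card ≤ 4 * d := by
          by_contra h
          exact hv (Finset.mem_filter.mpr ⟨hvS, by omega⟩)
        refine le_trans (Finset.card_le_card ?_) h3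
        intro w hw
        simp only [Finset.mem_filter] at hw ⊢
        exact ⟨hw.1, hw.2.1⟩

end Degenerate

/-! ### Greedy colouring with few monochromatic pairs -/

open Classical in
/-- Greedy colouring: if every vertex has at most `q` out-neighbours, then some proper colouring
with `2 q + t` colours makes at most a fraction `1 / t` of the total weight monochromatic. -/
theorem exists_coloring_weight_le (out : V → Finset V) (q t : ℕ) (ht : 0 < t)
    (hout : ∀ v, (out v).card ≤ q) (W : V → V → ℕ) (S : Finset V) :
    ∃ c : V → ℕ, (∀ v, c v < 2 * q + t) ∧
      (∀ v ∈ S, ∀ w ∈ S, v ≠ w → w ∈ out v → c v ≠ c w) ∧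
      t * ∑ v ∈ S, ∑ w ∈ S, (if v ≠ w ∧ c v = c w then W v w else 0) ≤
        ∑ v ∈ S, ∑ w ∈ S, W v w := by
  induction hn : S.card generalizing S with
  | zero =>
    have : S = ∅ := Finset.card_eq_zero.mp hn
    exact ⟨fun _ => 0, fun _ => show 0 < 2 * q + t by omega, by simp [this], by simp [this]⟩
  | succ n ih =>
    have hne : S.Nonempty := Finset.card_pos.mp (by omega)
    -- In-degrees and out-degrees within `S` have equal sums, so the average total degree is at most
    -- `2 * q`.
    obtain ⟨v, hv, hvq⟩ : ∃ v ∈ S,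
        (S.filter fun w => w ∈ out v).card + (S.filter fun w => v ∈ out w).card ≤ 2 * q := by
      refine Finset.exists_le_of_sum_le hne ?_
      rw [Finset.sum_add_distrib]
      have h1 : ∑ v ∈ S, (S.filter fun w => w ∈ out v).card ≤ ∑ v ∈ S, q :=
        Finset.sum_le_sum fun v _ => le_trans (Finset.card_le_card fun w hw =>
          (Finset.mem_filter.mp hw).2) (hout v)
      have h2 : ∑ v ∈ S, (S.filter fun w => v ∈ out w).card =
          ∑ v ∈ S, (S.filter fun w => w ∈ out v).card := by
        simp only [Finset.card_filter]
        exact Finset.sum_comm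
      simp only [Finset.sum_const, smul_eq_mul] at h1 ⊢
      nlinarith
    set S' := S.erase v with hS'
    obtain ⟨c, hc, hproper, hweight⟩ := ih S' (by rw [Finset.card_erase_of_mem hv, hn]; rfl)
    set A := Finset.range (2 * q + t) \
      ((S.filter fun w => w ∈ out v) ∪ (S.filter fun w => v ∈ out w)).image c with hA
    have hAcard : t ≤ A.card := by
      have h1 := Finset.le_card_sdiff
        (((S.filter fun w => w ∈ out v) ∪ (S.filter fun w => v ∈ out w)).image c)
        (Finset.range (2 * q + t))
      have h2 := (Finset.card_image_le (s := (S.filter fun w => w ∈ out v) ∪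
        (S.filter fun w => v ∈ out w)) (f := c)).trans (Finset.card_union_le _ _)
      rw [Finset.card_range, ← hA] at h1
      omega
    set cost : ℕ → ℕ := fun γ => ∑ w ∈ S', if γ = c w then W v w + W w v else 0 with hcost
    -- Each `w` contributes to the cost of at most one colour, and at least `t` colours are free;
    -- the cheapest free colour pays at most a `1 / t` share.
    obtain ⟨γ, hγ, hγcost⟩ : ∃ γ ∈ A, t * cost γ ≤ ∑ w ∈ S', (W v w + W w v) := by
      by_contra! hcon
      have hAne : A.Nonempty := Finset.card_pos.mp (by omega)
      have h1 : ∑ γ ∈ A, cost γ ≤ ∑ w ∈ S', (W v w + W w v) := by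
        rw [Finset.sum_comm]
        refine Finset.sum_le_sum fun w _ => ?_
        rw [Finset.sum_ite_eq' A (c w)]
        split_ifs <;> simp
      have h2 : ∑ γ ∈ A, (∑ w ∈ S', (W v w + W w v)) < ∑ γ ∈ A, t * cost γ :=
        Finset.sum_lt_sum_of_nonempty hAne hcon
      rw [Finset.sum_const, smul_eq_mul, ← Finset.mul_sum] at h2
      exact absurd h2 (not_lt.mpr ((Nat.mul_le_mul_left t h1).trans
        (Nat.mul_le_mul_right _ hAcard)))
    rw [hA, Finset.mem_sdiff, Finset.mem_range, Finset.mem_image] at hγ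
    have hupd : ∀ w ∈ S', Function.update c v γ w = c w := fun w hw =>
      Function.update_of_ne (Finset.ne_of_mem_erase hw) _ _
    refine ⟨Function.update c v γ, fun w => ?_, fun x hx y hy hxy hout' => ?_, ?_⟩
    · by_cases hw : w = v
      · subst hw; simpa using hγ.1
      · rw [Function.update_of_ne hw]; exact hc w
    · by_cases hxv : x = v
      · subst hxv
        rw [Function.update_self, Function.update_of_ne (Ne.symm hxy)]
        exact fun h => hγ.2 ⟨y, by simp [hy, hout'], h.symm⟩
      · by_cases hyv : y = v
        · subst hyv
          rw [Function.update_self, Function.update_of_ne hxy]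
          exact fun h => hγ.2 ⟨x, by simp [hx, hout'], h⟩
        · rw [Function.update_of_ne hxv, Function.update_of_ne hyv]
          exact hproper x (Finset.mem_erase.mpr ⟨hxv, hx⟩) y (Finset.mem_erase.mpr ⟨hyv, hy⟩)
            hxy hout'
    · have hsplit : ∀ f : V → V → ℕ, ∑ x ∈ S, ∑ y ∈ S, f x y =
          f v v + ∑ w ∈ S', (f v w + f w v) + ∑ x ∈ S', ∑ y ∈ S', f x y := by
        intro f
        rw [← Finset.add_sum_erase _ _ hv, ← Finset.add_sum_erase S (f v) hv,
          Finset.sum_congr rfl fun x _ => (Finset.add_sum_erase S (f x) hv).symm,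
          Finset.sum_add_distrib, Finset.sum_add_distrib]
        ring
      rw [hsplit, hsplit W]
      have h1 : ∑ w ∈ S', ((if v ≠ w ∧ Function.update c v γ v = Function.update c v γ w
            then W v w else 0) + if w ≠ v ∧ Function.update c v γ w = Function.update c v γ v
            then W w v else 0) = cost γ := by
        refine Finset.sum_congr rfl fun w hw => ?_
        have hwv := Finset.ne_of_mem_erase hw
        rw [hupd w hw, Function.update_self]
        by_cases h : γ = c w
        · simp [h, hwv, hwv.symm]
        · simp [h, Ne.symm h]
      have h2 : ∑ x ∈ S', ∑ y ∈ S', (if x ≠ y ∧ Function.update c v γ x =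
            Function.update c v γ y then W x y else 0) =
          ∑ x ∈ S', ∑ y ∈ S', (if x ≠ y ∧ c x = c y then W x y else 0) :=
        Finset.sum_congr rfl fun x hx => Finset.sum_congr rfl fun y hy => by
          rw [hupd x hx, hupd y hy]
      rw [h1, h2]
      simp only [ne_eq, not_true_eq_false, false_and, if_false]
      simp only [ne_eq] at hweight
      nlinarith

/-! ### Counting vertices reached by two kinds of steps -/

section Reach

variable [DecidableEq V]

/-- The vertices reachable from a given vertex by at most `p` steps of the two kinds `C` and `E`,
at most `a` of them of kind `E`. -/
def stepReach (C E : V → Finset V) : ℕ → ℕ → V → Finset V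
  | 0, _, v => {v}
  | p + 1, 0, v => {v} ∪ (C v).biUnion (stepReach C E p 0)
  | p + 1, a + 1, v =>
    ({v} ∪ (C v).biUnion (stepReach C E p (a + 1))) ∪ (E v).biUnion (stepReach C E p a)

variable {C E : V → Finset V}

theorem self_mem_stepReach (p a : ℕ) (v : V) : v ∈ stepReach C E p a v := by
  cases p <;> cases a <;> simp [stepReach]

theorem mem_stepReach_of_mem_left {p a : ℕ} {u v w : V} (hu : u ∈ C v)
    (hw : w ∈ stepReach C E p a u) : w ∈ stepReach C E (p + 1) a v := by
  cases a <;> simp only [stepReach, Finset.mem_union, Finset.mem_biUnion]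
  · exact Or.inr ⟨u, hu, hw⟩
  · exact Or.inl (Or.inr ⟨u, hu, hw⟩)

theorem mem_stepReach_of_mem_right {p a : ℕ} {u v w : V} (hu : u ∈ E v)
    (hw : w ∈ stepReach C E p a u) : w ∈ stepReach C E (p + 1) (a + 1) v := by
  simp only [stepReach, Finset.mem_union, Finset.mem_biUnion]
  exact Or.inr ⟨u, hu, hw⟩

theorem stepReach_mono {p p' a a' : ℕ} (hp : p ≤ p') (ha : a ≤ a') (v : V) :
    stepReach C E p a v ⊆ stepReach C E p' a' v := by
  induction p generalizing p' a a' v with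
  | zero => simpa [stepReach] using self_mem_stepReach p' a' v
  | succ p ih =>
    obtain ⟨p', rfl⟩ : ∃ k, p' = k + 1 := ⟨p' - 1, by omega⟩
    intro w hw
    cases a with
    | zero =>
      simp only [stepReach, Finset.mem_union, Finset.mem_biUnion, Finset.mem_singleton] at hw
      rcases hw with rfl | ⟨u, hu, hw⟩
      · exact self_mem_stepReach _ _ _
      · exact mem_stepReach_of_mem_left hu (ih (by omega) ha u hw)
    | succ a =>
      obtain ⟨a', rfl⟩ : ∃ k, a' = k + 1 := ⟨a' - 1, by omega⟩
      simp only [stepReach, Finset.mem_union, Finset.mem_biUnion, Finset.mem_singleton] at hw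
      rcases hw with (rfl | ⟨u, hu, hw⟩) | ⟨u, hu, hw⟩
      · exact self_mem_stepReach _ _ _
      · exact mem_stepReach_of_mem_left hu (ih (by omega) ha u hw)
      · exact mem_stepReach_of_mem_right hu (ih (by omega) (by omega) u hw)

theorem mem_stepReach_succ_of_mem {p : ℕ} {u v w : V} (hu : u ∈ stepReach C E p 0 v)
    (hw : w ∈ C u) : w ∈ stepReach C E (p + 1) 0 v := by
  induction p generalizing v with
  | zero =>
    simp only [stepReach, Finset.mem_singleton] at hu
    subst hu
    exact mem_stepReach_of_mem_left hw (self_mem_stepReach _ _ _)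
  | succ p ih =>
    simp only [stepReach, Finset.mem_union, Finset.mem_biUnion, Finset.mem_singleton] at hu
    rcases hu with rfl | ⟨x, hx, hu⟩
    · exact mem_stepReach_of_mem_left hw (self_mem_stepReach _ _ _)
    · exact mem_stepReach_of_mem_left hx (ih hu)

/-- Only `E`-steps pay a factor `D`. In each factor `q + 2`, `q` accounts for the `C`-steps, one
unit for `v` itself, and one for the `E`-branch, whose `D` goes into the power of `D`. -/
theorem card_stepReach_le {q D : ℕ} (hD : 1 ≤ D) (hC : ∀ v, (C v).card ≤ q)
    (hE : ∀ v, (E v).card ≤ D) (p a : ℕ) (v : V) :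
    (stepReach C E p a v).card ≤ (q + 2) ^ p * D ^ a := by
  induction p generalizing a v with
  | zero => simpa [stepReach] using Nat.one_le_pow _ _ hD
  | succ p ih =>
    have hpos : ∀ a, 1 ≤ (q + 2) ^ p * D ^ a := fun a => Nat.mul_pos (by positivity)
      (Nat.one_le_pow _ _ hD)
    have hCb : ∀ a, ((C v).biUnion (stepReach C E p a)).card ≤ q * ((q + 2) ^ p * D ^ a) :=
      fun a => (Finset.card_biUnion_le_card_mul _ _ _ fun u _ => ih a u).trans
        (Nat.mul_le_mul_right _ (hC v))
    have hEb : ∀ a, ((E v).biUnion (stepReach C E p a)).card ≤ D * ((q + 2) ^ p * D ^ a) :=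
      fun a => (Finset.card_biUnion_le_card_mul _ _ _ fun u _ => ih a u).trans
        (Nat.mul_le_mul_right _ (hE v))
    cases a with
    | zero =>
      simp only [stepReach]
      refine (Finset.card_union_le _ _).trans ?_
      have h1 := hCb 0
      have h2 := hpos 0
      rw [Finset.card_singleton, pow_succ]
      nlinarith
    | succ a =>
      simp only [stepReach]
      refine (Finset.card_union_le _ _).trans
        ((Nat.add_le_add_right (Finset.card_union_le _ _) _).trans ?_)
      have h1 := hCb (a + 1)
      have h2 := hpos (a + 1)
      have h3 := hEb a
      have h4 : D * ((q + 2) ^ p * D ^ a) = (q + 2) ^ p * D ^ (a + 1) := by ring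
      have h5 : (q + 2) ^ (p + 1) * D ^ (a + 1) = q * ((q + 2) ^ p * D ^ (a + 1)) +
        2 * ((q + 2) ^ p * D ^ (a + 1)) := by ring
      rw [Finset.card_singleton]
      omega

end Reach

/-! ### Down-steps of a walk and of its reverse -/

section DownSteps

variable (G : SimpleGraph V) (lam : V → ℕ)

open Classical in
/-- The number of steps of a walk that go to a lower layer. -/
noncomputable def downSteps {v w : V} (p : G.Walk v w) : ℕ :=
  p.darts.countP fun e => lam e.snd < lam e.fst

variable {G lam}

theorem downSteps_cons_of_lt {u v w : V} (h : G.Adj u v) (p : G.Walk v w) (hl : lam v < lam u) :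
    downSteps G lam (Walk.cons h p) = downSteps G lam p + 1 := by
  simp [downSteps, hl]

theorem downSteps_cons_of_le {u v w : V} (h : G.Adj u v) (p : G.Walk v w) (hl : lam u ≤ lam v) :
    downSteps G lam (Walk.cons h p) = downSteps G lam p := by
  simp [downSteps, hl]

theorem downSteps_add_downSteps_reverse_le {v w : V} (p : G.Walk v w) :
    downSteps G lam p + downSteps G lam p.reverse ≤ p.length := by
  classical
  rw [downSteps, downSteps, Walk.darts_reverse, List.countP_reverse, List.countP_map,
    ← Walk.length_darts]
  induction p.darts with
  | nil => simp
  | cons e l ih =>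
    simp only [List.countP_cons, Function.comp_apply, List.length_cons] at ih ⊢
    by_cases h : lam e.snd < lam e.fst
    · simp only [Dart.symm, h, decide_true, if_true, Prod.fst_swap, Prod.snd_swap, h.not_gt,
        decide_false] at ih ⊢
      simp only [Bool.false_eq_true, if_false]
      omega
    · have : ∀ b : Bool, (if b = true then 1 else 0) ≤ 1 := by decide
      have := this (decide (lam e.symm.snd < lam e.symm.fst))
      simp only [h, decide_false, Bool.false_eq_true, if_false]
      omega

end DownSteps

/-! ### Cutting walks at their first or last down-step -/

section Layering

variable [Fintype V] (G : SimpleGraph V) (lam : V → ℕ) (Z : Finset V)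

open Classical in
/-- The neighbours of `v` that are not in a lower layer. -/
noncomputable def upNeighbors (v : V) : Finset V :=
  Finset.univ.filter fun w => G.Adj v w ∧ lam v ≤ lam w

open Classical in
/-- The neighbours of `v` in lower layers, or nothing if `v ∈ Z`. -/
noncomputable def downNeighbors (v : V) : Finset V :=
  Finset.univ.filter fun w => v ∉ Z ∧ G.Adj v w ∧ lam w < lam v

open Classical in
/-- The vertices reachable by walks with at most `p` steps, at most `a` of which go down. -/
noncomputable abbrev layerReach (p a : ℕ) (v : V) : Finset V :=
  stepReach (upNeighbors G lam) (downNeighbors G lam Z) p a v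

variable {G lam Z}

theorem mem_upNeighbors {v w : V} : w ∈ upNeighbors G lam v ↔ G.Adj v w ∧ lam v ≤ lam w := by
  simp [upNeighbors]

theorem mem_downNeighbors {v w : V} :
    w ∈ downNeighbors G lam Z v ↔ v ∉ Z ∧ G.Adj v w ∧ lam w < lam v := by
  simp [downNeighbors]

theorem mem_layerReach_of_walk {v w : V} (p : G.Walk v w) (hZ : ∀ x ∈ p.support, x ∉ Z) :
    w ∈ layerReach G lam Z p.length (downSteps G lam p) v := by
  classical
  induction p with
  | nil => exact self_mem_stepReach _ _ _
  | @cons v u w h p ih =>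
    rw [Walk.support_cons, List.forall_mem_cons] at hZ
    rw [Walk.length_cons]
    rcases lt_or_ge (lam u) (lam v) with hl | hl
    · rw [downSteps_cons_of_lt h p hl]
      exact mem_stepReach_of_mem_right (mem_downNeighbors.mpr ⟨hZ.1, h, hl⟩) (ih hZ.2)
    · rw [downSteps_cons_of_le h p hl]
      exact mem_stepReach_of_mem_left (mem_upNeighbors.mpr ⟨h, hl⟩) (ih hZ.2)

/-- Splitting a walk that stays below the layer of its first vertex after its first step down. -/
theorem mem_layerReach_or_exists_first {v w : V} (p : G.Walk v w) (hZ : ∀ x ∈ p.support, x ∉ Z)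
    (hmax : ∀ x ∈ p.support, lam x ≤ lam v) :
    w ∈ layerReach G lam Z p.length 0 v ∨ ∃ x ∈ p.support, ∃ a, a + 1 ≤ downSteps G lam p ∧
      v ∈ layerReach G lam Z p.length 0 x ∧ w ∈ layerReach G lam Z p.length a x := by
  classical
  induction p with
  | nil => exact Or.inl (self_mem_stepReach _ _ _)
  | @cons v u w h p ih =>
    rw [Walk.support_cons, List.forall_mem_cons] at hZ hmax
    rw [Walk.length_cons, Walk.support_cons]
    have hu : lam u ≤ lam v := hmax.2 u p.start_mem_support
    rcases hu.lt_or_eq with hl | hl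
    · right
      rw [downSteps_cons_of_lt h p hl]
      refine ⟨u, List.mem_cons_of_mem _ p.start_mem_support, downSteps G lam p, le_rfl, ?_, ?_⟩
      · exact mem_stepReach_of_mem_left (mem_upNeighbors.mpr ⟨h.symm, hu⟩)
          (self_mem_stepReach _ _ _)
      · exact stepReach_mono (Nat.le_succ _) le_rfl _ (mem_layerReach_of_walk p hZ.2)
    -- Since the walk never rises above its start, a step that is not down stays in the layer; such
    -- an edge can be used in both directions, which is what lets `x` reach back to `v`.
    · rw [downSteps_cons_of_le h p hl.ge]
      rcases ih hZ.2 (fun x hx => (hmax.2 x hx).trans hl.ge) with hw | ⟨x, hx, a, ha, hv, hw⟩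
      · exact Or.inl (mem_stepReach_of_mem_left (mem_upNeighbors.mpr ⟨h, hl.ge⟩) hw)
      · exact Or.inr ⟨x, List.mem_cons_of_mem _ hx, a, ha,
          mem_stepReach_succ_of_mem hv (mem_upNeighbors.mpr ⟨h.symm, hl.le⟩),
          stepReach_mono (Nat.le_succ _) le_rfl _ hw⟩

/-- Splitting a walk at its last step down. -/
theorem mem_layerReach_or_exists_last {v w : V} (p : G.Walk v w) (hZ : ∀ x ∈ p.support, x ∉ Z) :
    w ∈ layerReach G lam Z p.length 0 v ∨ ∃ u ∈ p.support, ∃ a, a + 1 ≤ downSteps G lam p ∧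
      u ∈ layerReach G lam Z p.length a v ∧ ∃ y ∈ downNeighbors G lam Z u,
        w ∈ layerReach G lam Z p.length 0 y := by
  classical
  induction p with
  | nil => exact Or.inl (self_mem_stepReach _ _ _)
  | @cons v u w h p ih =>
    rw [Walk.support_cons, List.forall_mem_cons] at hZ
    rw [Walk.length_cons, Walk.support_cons]
    rcases lt_or_ge (lam u) (lam v) with hl | hl
    · have hd : u ∈ downNeighbors G lam Z v := mem_downNeighbors.mpr ⟨hZ.1, h, hl⟩
      rw [downSteps_cons_of_lt h p hl]
      rcases ih hZ.2 with hw | ⟨x, hx, a, ha, hu, y, hy, hw⟩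
      -- The current step is the last one down, so no down-step precedes it.
      · exact Or.inr ⟨v, List.mem_cons_self, 0, by omega, self_mem_stepReach _ _ _, u, hd,
          stepReach_mono (Nat.le_succ _) le_rfl _ hw⟩
      · exact Or.inr ⟨x, List.mem_cons_of_mem _ hx, a + 1, by omega,
          mem_stepReach_of_mem_right hd hu, y, hy,
          stepReach_mono (Nat.le_succ _) le_rfl _ hw⟩
    · have hd : u ∈ upNeighbors G lam v := mem_upNeighbors.mpr ⟨h, hl⟩
      rw [downSteps_cons_of_le h p hl]
      rcases ih hZ.2 with hw | ⟨x, hx, a, ha, hu, y, hy, hw⟩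
      · exact Or.inl (mem_stepReach_of_mem_left hd hw)
      · exact Or.inr ⟨x, List.mem_cons_of_mem _ hx, a, ha,
          mem_stepReach_of_mem_left hd hu, y, hy,
          stepReach_mono (Nat.le_succ _) le_rfl _ hw⟩

end Layering

/-! ### The two colourings and the exceptional sets -/

section Colorings

variable [Fintype V] {G : SimpleGraph V} {lam : V → ℕ} {Z : Finset V} {q s : ℕ}

open Classical in
/-- The vertices `x` for which two distinct vertices of the same colour are reachable from `x`, one
of them without going down and the other one with at most `t` steps down. -/
noncomputable def badVertices (G : SimpleGraph V) (lam : V → ℕ) (Z : Finset V) (ℓ t : ℕ)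
    (c : V → ℕ) : Finset V :=
  Finset.univ.filter fun x => ∃ v w, v ≠ w ∧ c v = c w ∧
    v ∈ layerReach G lam Z ℓ 0 x ∧ w ∈ layerReach G lam Z ℓ t x

open Classical in
/-- The vertices from which `R` can be reached without going down. -/
noncomputable def shadow (G : SimpleGraph V) (lam : V → ℕ) (Z : Finset V) (ℓ : ℕ)
    (R : Finset V) : Finset V :=
  R.biUnion fun x => Finset.univ.filter fun y => x ∈ layerReach G lam Z ℓ 0 y

open Classical in
/-- The vertices with more than `s` down-neighbours in `Y`. -/
noncomputable def overloaded (G : SimpleGraph V) (lam : V → ℕ) (Z : Finset V) (s : ℕ)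
    (Y : Finset V) : Finset V :=
  Finset.univ.filter fun u => s < (downNeighbors G lam Z u ∩ Y).card

/-- Each `x` sees `O(s^(2t))` pairs that could make it bad, and only a `1 / s^(2t+1)` share of the
total weight stays monochromatic. This leaves a factor `1 / s`. -/
theorem exists_coloring_shadow_le (hs : 1 ≤ s) (hup : ∀ v, (upNeighbors G lam v).card ≤ q)
    (hdown : ∀ v, (downNeighbors G lam Z v).card ≤ s ^ 2) (ℓ t : ℕ) :
    ∃ c : V → ℕ, (∀ v, c v < 2 * (q + 2) ^ ℓ + s ^ (2 * t + 1)) ∧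
      (∀ v w, v ≠ w → w ∈ layerReach G lam Z ℓ 0 v → c v ≠ c w) ∧
      s * (shadow G lam Z ℓ (badVertices G lam Z ℓ t c)).card ≤
        Fintype.card V * (q + 2) ^ (3 * ℓ) := by
  classical
  have hs2 : 1 ≤ s ^ 2 := Nat.one_le_pow _ _ hs
  have hreach := fun p a v => card_stepReach_le hs2 hup hdown p a v
  have hreach0 : ∀ v, (layerReach G lam Z ℓ 0 v).card ≤ (q + 2) ^ ℓ := fun v => by
    simpa using hreach ℓ 0 v
  -- Weighting `x` by the size of its own shadow makes the greedy step control the shadow of the bad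
  -- set and not merely its size.
  set ω : V → ℕ := fun x => (Finset.univ.filter fun y => x ∈ layerReach G lam Z ℓ 0 y).card
    with hω
  set P : V → V → V → Prop := fun x v w =>
    v ∈ layerReach G lam Z ℓ 0 x ∧ w ∈ layerReach G lam Z ℓ t x with hP
  set W : V → V → ℕ := fun v w => ∑ x, if P x v w then ω x else 0 with hW
  obtain ⟨c, hc, hproper, hweight⟩ := exists_coloring_weight_le (layerReach G lam Z ℓ 0)
    ((q + 2) ^ ℓ) (s ^ (2 * t + 1)) (by positivity) hreach0 W Finset.univ
  refine ⟨c, hc, fun v w => hproper v (Finset.mem_univ _) w (Finset.mem_univ _), ?_⟩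
  set R := badVertices G lam Z ℓ t c with hR
  have hωsum : ∑ x, ω x ≤ Fintype.card V * (q + 2) ^ ℓ := by
    have : ∑ x, ω x = ∑ y, (layerReach G lam Z ℓ 0 y).card := by
      simp only [hω, Finset.card_filter]
      rw [Finset.sum_comm]
      simp
    rw [this, ← smul_eq_mul, ← Finset.card_univ]
    exact Finset.sum_le_card_nsmul _ _ _ fun y _ => hreach0 y
  have htotal : ∑ v, ∑ w, W v w ≤
      Fintype.card V * (q + 2) ^ ℓ * ((q + 2) ^ ℓ * ((q + 2) ^ ℓ * s ^ (2 * t))) := by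
    have h1 : ∑ v, ∑ w, W v w = ∑ x, ∑ v, ∑ w, if P x v w then ω x else 0 := by
      simp only [hW]
      rw [Finset.sum_congr rfl fun v _ => Finset.sum_comm, Finset.sum_comm]
    have h2 : ∀ x, (∑ v, ∑ w, if P x v w then ω x else 0) ≤
        ω x * ((q + 2) ^ ℓ * ((q + 2) ^ ℓ * s ^ (2 * t))) := by
      intro x
      have h3 : (∑ v, ∑ w, if P x v w then ω x else 0) =
          (layerReach G lam Z ℓ 0 x).card * ((layerReach G lam Z ℓ t x).card * ω x) := by
        simp only [hP, ite_and]
        have h4 : ∀ v, (∑ w, if v ∈ layerReach G lam Z ℓ 0 x then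
            (if w ∈ layerReach G lam Z ℓ t x then ω x else 0) else 0) =
            if v ∈ layerReach G lam Z ℓ 0 x then (layerReach G lam Z ℓ t x).card * ω x
              else 0 := by
          intro v
          split_ifs <;> simp
        rw [Finset.sum_congr rfl fun v _ => h4 v]
        simp
      have h5 := hreach ℓ t x
      rw [← pow_mul] at h5
      rw [h3, ← mul_assoc, mul_comm]
      exact Nat.mul_le_mul_left _ (Nat.mul_le_mul (hreach0 x) h5)
    rw [h1]
    refine (Finset.sum_le_sum fun x _ => h2 x).trans ?_
    rw [← Finset.sum_mul]
    exact Nat.mul_le_mul_right _ hωsum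
  have hbad : ∑ x ∈ R, ω x ≤ ∑ v, ∑ w, if v ≠ w ∧ c v = c w then W v w else 0 := by
    have h1 : (∑ v, ∑ w, if v ≠ w ∧ c v = c w then W v w else 0) =
        ∑ x, ∑ v, ∑ w, if v ≠ w ∧ c v = c w then (if P x v w then ω x else 0) else 0 := by
      have h2 : ∀ v w, (if v ≠ w ∧ c v = c w then W v w else 0) =
          ∑ x, if v ≠ w ∧ c v = c w then (if P x v w then ω x else 0) else 0 := by
        intro v w
        split_ifs
        · rfl
        · simp
      simp only [h2]
      rw [Finset.sum_congr rfl fun v _ => Finset.sum_comm, Finset.sum_comm]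
    rw [h1]
    refine (Finset.sum_le_sum fun x hx => ?_).trans
      (Finset.sum_le_sum_of_subset (Finset.subset_univ R))
    simp only [hR, badVertices, Finset.mem_filter, Finset.mem_univ, true_and] at hx
    obtain ⟨v, w, hne, heq, hv, hw⟩ := hx
    have h3 : ω x = if v ≠ w ∧ c v = c w then (if P x v w then ω x else 0) else 0 := by
      rw [if_pos ⟨hne, heq⟩, if_pos ⟨hv, hw⟩]
    calc ω x = if v ≠ w ∧ c v = c w then (if P x v w then ω x else 0) else 0 := h3
      _ ≤ ∑ w, if v ≠ w ∧ c v = c w then (if P x v w then ω x else 0) else 0 :=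
        Finset.single_le_sum (f := fun w => if v ≠ w ∧ c v = c w then
          (if P x v w then ω x else 0) else 0) (fun _ _ => Nat.zero_le _) (Finset.mem_univ w)
      _ ≤ _ := Finset.single_le_sum (f := fun v => ∑ w, if v ≠ w ∧ c v = c w then
          (if P x v w then ω x else 0) else 0) (fun _ _ => Nat.zero_le _) (Finset.mem_univ v)
  have hshadow : (shadow G lam Z ℓ R).card ≤ ∑ x ∈ R, ω x := Finset.card_biUnion_le
  have hfinal := (Nat.mul_le_mul_left (s ^ (2 * t + 1)) (hshadow.trans hbad)).trans
    (hweight.trans htotal)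
  have hpos : 0 < s ^ (2 * t) := by positivity
  refine Nat.le_of_mul_le_mul_left ?_ hpos
  calc s ^ (2 * t) * (s * (shadow G lam Z ℓ R).card)
      = s ^ (2 * t + 1) * (shadow G lam Z ℓ R).card := by ring
    _ ≤ _ := hfinal
    _ = s ^ (2 * t) * (Fintype.card V * (q + 2) ^ (3 * ℓ)) := by ring

/-- Double counting: a down-edge into `y ∈ Y` is an up-edge out of `y`, and there are at most `q` of
those. -/
theorem mul_card_overloaded_le (hup : ∀ v, (upNeighbors G lam v).card ≤ q) (Y : Finset V) :
    s * (overloaded G lam Z s Y).card ≤ q * Y.card := by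
  classical
  have h1 : s * (overloaded G lam Z s Y).card ≤ ∑ u, (downNeighbors G lam Z u ∩ Y).card := by
    rw [mul_comm, ← smul_eq_mul]
    exact (Finset.card_nsmul_le_sum _ _ _ fun u hu => ((Finset.mem_filter.mp hu).2).le).trans
      (Finset.sum_le_sum_of_subset (Finset.subset_univ _))
  refine h1.trans ?_
  have h2 : ∀ u, (downNeighbors G lam Z u ∩ Y).card ≤
      ∑ y ∈ Y, if u ∈ upNeighbors G lam y then 1 else 0 := by
    intro u
    rw [← Finset.card_filter]
    refine Finset.card_le_card fun y hy => ?_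
    rw [Finset.mem_inter, mem_downNeighbors] at hy
    exact Finset.mem_filter.mpr ⟨hy.2, mem_upNeighbors.mpr ⟨hy.1.2.1.symm, hy.1.2.2.le⟩⟩
  refine (Finset.sum_le_sum fun u _ => h2 u).trans ?_
  rw [Finset.sum_comm, mul_comm, ← smul_eq_mul]
  refine Finset.sum_le_card_nsmul _ _ _ fun y _ => ?_
  simpa using hup y

theorem exists_coloring_avoiding_overloaded (hs : 1 ≤ s)
    (hup : ∀ v, (upNeighbors G lam v).card ≤ q)
    (hdown : ∀ v, (downNeighbors G lam Z v).card ≤ s ^ 2) (ℓ t : ℕ) (R : Finset V) :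
    ∃ c : V → ℕ,
      (∀ v, c v < 2 * ((q + 2) ^ ℓ + (q + 2) ^ (2 * ℓ) * s ^ (2 * t + 1)) + 1) ∧
      ∀ v, ∀ w ∈ R, v ≠ w → (w ∈ layerReach G lam Z ℓ 0 v ∨
        ∃ u ∈ layerReach G lam Z ℓ t v, u ∉ overloaded G lam Z s (shadow G lam Z ℓ R) ∧
          ∃ y ∈ downNeighbors G lam Z u, w ∈ layerReach G lam Z ℓ 0 y) → c v ≠ c w := by
  classical
  have hs2 : 1 ≤ s ^ 2 := Nat.one_le_pow _ _ hs
  have hreach := fun p a v => card_stepReach_le hs2 hup hdown p a v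
  have hreach0 : ∀ v, (layerReach G lam Z ℓ 0 v).card ≤ (q + 2) ^ ℓ := fun v => by
    simpa using hreach ℓ 0 v
  set Y := shadow G lam Z ℓ R with hY
  set O := overloaded G lam Z s Y with hO
  -- Intersecting with `Y` loses nothing, as `y` reaches `w ∈ R` upwards; it leaves at most `s`
  -- choices for `y`, so the count is `s^(2t) * s`.
  set out : V → Finset V := fun v => layerReach G lam Z ℓ 0 v ∪
    ((layerReach G lam Z ℓ t v).filter fun u => u ∉ O).biUnion fun u =>
      (downNeighbors G lam Z u ∩ Y).biUnion fun y => layerReach G lam Z ℓ 0 y with hout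
  have hcard : ∀ v, (out v).card ≤ (q + 2) ^ ℓ + (q + 2) ^ (2 * ℓ) * s ^ (2 * t + 1) := by
    intro v
    refine (Finset.card_union_le _ _).trans (Nat.add_le_add (hreach0 v) ?_)
    refine (Finset.card_biUnion_le_card_mul _ _ (s * (q + 2) ^ ℓ) fun u hu => ?_).trans ?_
    · refine (Finset.card_biUnion_le_card_mul _ _ _ fun y _ => hreach0 y).trans
        (Nat.mul_le_mul_right _ ?_)
      have := (Finset.mem_filter.mp hu).2
      simpa [hO, overloaded] using this
    · have h1 := (Finset.card_filter_le (layerReach G lam Z ℓ t v) fun u => u ∉ O).trans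
        (hreach ℓ t v)
      refine (Nat.mul_le_mul_right _ h1).trans (le_of_eq ?_)
      ring
  -- Only properness matters here, hence zero weights and a single spare colour.
  obtain ⟨c, hc, hproper, -⟩ := exists_coloring_weight_le out _ 1 one_pos hcard
    (fun _ _ => 0) Finset.univ
  refine ⟨c, hc, fun v w hwR hne hw =>
    hproper v (Finset.mem_univ _) w (Finset.mem_univ _) hne ?_⟩
  rcases hw with hw | ⟨u, hu, huO, y, hy, hw⟩
  · exact Finset.mem_union_left _ hw
  · refine Finset.mem_union_right _ (Finset.mem_biUnion.mpr ⟨u, Finset.mem_filter.mpr ⟨hu, huO⟩,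
      Finset.mem_biUnion.mpr ⟨y, Finset.mem_inter.mpr ⟨hy, ?_⟩, hw⟩⟩)
    exact Finset.mem_biUnion.mpr ⟨w, hwR, by simpa using hw⟩

end Colorings

/-! ### Assembling the three tiers -/

open Classical in
/-- The three-tier colouring: layered base colours `c₁`, above them colours `c₂` on `R`, and above
these distinct colours on `T`. -/
theorem isVertexRanking_of_colorings [Fintype V] {G : SimpleGraph V} {lam c₁ c₂ ι : V → ℕ}
    {Z R T : Finset V} {ℓ t m k₁ k₂ : ℕ} (hℓ : ℓ ≤ 2 * t + 3) (hm : ∀ v, lam v < m)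
    (hc₁ : ∀ v, c₁ v < k₁) (hc₂ : ∀ v, c₂ v < k₂) (hι : Set.InjOn ι T) (hZT : Z ⊆ T)
    (hreach : ∀ v w, v ≠ w → w ∈ layerReach G lam Z ℓ 0 v → c₁ v ≠ c₁ w)
    (hbad : badVertices G lam Z ℓ t c₁ ⊆ R)
    (hR : ∀ v, ∀ w ∈ R, v ≠ w → (w ∈ layerReach G lam Z ℓ 0 v ∨
      ∃ u ∈ layerReach G lam Z ℓ t v, u ∉ T ∧
        ∃ y ∈ downNeighbors G lam Z u, w ∈ layerReach G lam Z ℓ 0 y) → c₂ v ≠ c₂ w) :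
    G.IsVertexRanking ℓ fun v =>
      if v ∈ T then m * k₁ + k₂ + ι v else if v ∈ R then m * k₁ + c₂ v
        else lam v * k₁ + c₁ v := by
  have hbase : ∀ v, lam v * k₁ + c₁ v < m * k₁ := fun v => by
    have := hc₁ v
    have := Nat.mul_le_mul_right k₁ (hm v)
    rw [Nat.succ_mul] at this
    omega
  refine isVertexRanking_of_walk fun v w p hne heq hlen => ?_
  by_contra! hcon
  by_cases hvT : v ∈ T
  · have hwT : w ∈ T := by
      by_contra hwT
      have := hbase w
      have := hc₂ w
      simp only [hvT, hwT, if_true, if_false] at heq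
      split_ifs at heq <;> omega
    simp only [hvT, hwT, if_true] at heq
    exact hne (hι hvT hwT (by omega))
  have hpT : ∀ x ∈ p.support, x ∉ T := by
    intro x hx hxT
    have h1 := hcon x hx
    have := hbase v
    have := hc₂ v
    simp only [hvT, hxT, if_true, if_false] at h1
    split_ifs at h1 <;> omega
  have hwT : w ∉ T := hpT w p.end_mem_support
  -- The two counts add up to at most `2 * t + 3`, so they cannot both reach `t + 2`.
  have hdir : downSteps G lam p ≤ t + 1 ∨ downSteps G lam p.reverse ≤ t + 1 := by
    have := downSteps_add_downSteps_reverse_le (lam := lam) p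
    omega
  have hrev : ∀ {P : V → Prop}, (∀ x ∈ p.support, P x) → ∀ x ∈ p.reverse.support, P x :=
    fun h x hx => h x (by simpa using hx)
  by_cases hvR : v ∈ R
  · have hwR : w ∈ R := by
      by_contra hwR
      have := hbase w
      simp only [hvT, hwT, hvR, hwR, if_true, if_false] at heq
      omega
    simp only [hvT, hwT, hvR, hwR, if_true, if_false] at heq
    have key : ∀ (v w : V) (p : G.Walk v w), w ∈ R → v ≠ w → p.length ≤ ℓ →
        (∀ x ∈ p.support, x ∉ T) → downSteps G lam p ≤ t + 1 → c₂ v ≠ c₂ w := by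
      intro v w p hw hne hlen hpT hd
      refine hR v w hw hne ?_
      rcases mem_layerReach_or_exists_last (lam := lam) p fun x hx hxZ => hpT x hx (hZT hxZ) with
        h | ⟨u, hu, a, ha, hua, y, hy, hwy⟩
      · exact Or.inl (stepReach_mono hlen le_rfl _ h)
      · exact Or.inr ⟨u, stepReach_mono hlen (by omega) _ hua, hpT u hu, y, hy,
          stepReach_mono hlen le_rfl _ hwy⟩
    rcases hdir with hd | hd
    · exact key v w p hwR hne hlen hpT hd (by omega)
    · exact key w v p.reverse hvR hne.symm (by simpa using hlen) (hrev hpT) hd (by omega)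
  have hpR : ∀ x ∈ p.support, x ∉ R := by
    intro x hx hxR
    have h1 := hcon x hx
    have := hbase v
    simp only [hvT, hvR, hxR, hpT x hx, if_true, if_false] at h1
    omega
  have hwR : w ∉ R := hpR w p.end_mem_support
  -- Layers use disjoint blocks of `k₁` colours, so a vertex in a higher layer would have a larger
  -- colour.
  have hle : ∀ x ∈ p.support, lam x ≤ lam v := by
    intro x hx
    have h1 := hcon x hx
    simp only [hvT, hvR, hpR x hx, hpT x hx, if_false] at h1
    by_contra! hlt
    have h2 := Nat.mul_le_mul_right k₁ hlt
    rw [Nat.succ_mul] at h2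
    have := hc₁ v
    omega
  simp only [hvT, hwT, hvR, hwR, if_false] at heq
  have hlam : lam v = lam w := by
    refine le_antisymm ?_ (hle w p.end_mem_support)
    by_contra! hlt
    have h2 := Nat.mul_le_mul_right k₁ hlt
    rw [Nat.succ_mul] at h2
    have := hc₁ w
    omega
  have hcol : c₁ v = c₁ w := by
    rw [hlam] at heq
    omega
  have key : ∀ (v w : V) (p : G.Walk v w), v ≠ w → p.length ≤ ℓ → (∀ x ∈ p.support, x ∉ T) →
      (∀ x ∈ p.support, x ∉ R) → (∀ x ∈ p.support, lam x ≤ lam v) →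
      downSteps G lam p ≤ t + 1 → c₁ v ≠ c₁ w := by
    intro v w p hne hlen hpT hpR hle hd hcol
    rcases mem_layerReach_or_exists_first (lam := lam) p (fun x hx hxZ => hpT x hx (hZT hxZ))
      hle with h | ⟨x, hx, a, ha, hvx, hwx⟩
    · exact hreach v w hne (stepReach_mono hlen le_rfl _ h) hcol
    · exact hpR x hx (hbad (Finset.mem_filter.mpr ⟨Finset.mem_univ _, v, w, hne, hcol,
        stepReach_mono hlen le_rfl _ hvx, stepReach_mono hlen (by omega) _ hwx⟩))
  rcases hdir with hd | hd
  · exact key v w p hne hlen hpT hpR hle hd hcol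
  · exact key w v p.reverse hne.symm (by simpa using hlen) (hrev hpT) (hrev hpR)
      (hrev fun x hx => hlam ▸ hle x hx) hd hcol.symm

/-! ### Counting colours and choosing parameters -/

theorem IsDegenerate.vertexRankingNumber_le [Fintype V] {G : SimpleGraph V} {d ℓ t m s : ℕ}
    (hd : 1 ≤ d) (hG : G.IsDegenerate d) (hℓ : ℓ ≤ 2 * t + 3) (hs : 1 ≤ s)
    (hcard : Fintype.card V ≤ s ^ (2 * t + 3)) (hm : Fintype.card V < 2 ^ m) :
    G.vertexRankingNumber ℓ ≤ (3 * (4 * d + 2) ^ ℓ + 5 * (4 * d + 2) ^ (2 * ℓ) + 2 * d +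
      4 * d * (4 * d + 2) ^ (3 * ℓ)) * (m + 1) * s ^ (2 * t + 1) := by
  classical
  obtain ⟨lam, hlam, hlayer⟩ := hG.exists_layering hd m Finset.univ (by simpa using hm)
  set Z : Finset V := Finset.univ.filter fun v => s ^ 2 < (Finset.univ.filter (G.Adj v)).card
    with hZ
  have hup : ∀ v, (upNeighbors G lam v).card ≤ 4 * d := fun v => by
    refine (Finset.card_le_card fun w hw => ?_).trans (hlayer v (Finset.mem_univ v))
    simpa using mem_upNeighbors.mp hw
  have hdown : ∀ v, (downNeighbors G lam Z v).card ≤ s ^ 2 := by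
    intro v
    by_cases hv : v ∈ Z
    · simp [downNeighbors, hv]
    · have h1 : (Finset.univ.filter (G.Adj v)).card ≤ s ^ 2 := by simpa [hZ] using hv
      refine (Finset.card_le_card fun w hw => ?_).trans h1
      simpa using (mem_downNeighbors.mp hw).2.1
  obtain ⟨c₁, hc₁, hreach, hshadow⟩ := exists_coloring_shadow_le hs hup hdown ℓ t
  set R := badVertices G lam Z ℓ t c₁ with hR
  set Y := shadow G lam Z ℓ R with hY
  set O := overloaded G lam Z s Y with hO
  obtain ⟨c₂, hc₂, hconf⟩ := exists_coloring_avoiding_overloaded hs hup hdown ℓ t R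
  set T := Z ∪ O with hT
  obtain ⟨ι, hι, hιT⟩ : ∃ ι : V → ℕ, Set.InjOn ι T ∧ ∀ v ∈ T, ι v < T.card := by
    refine ⟨fun v => if h : v ∈ T then T.equivFin ⟨v, h⟩ else 0, fun v hv w hw h => ?_,
      fun v hv => ?_⟩
    · have hv' : v ∈ T := hv
      have hw' : w ∈ T := hw
      simp only [hv', hw', dif_pos] at h
      simpa using T.equivFin.injective (Fin.ext h)
    · simp only [hv, dif_pos]
      exact (T.equivFin ⟨v, hv⟩).2
  have hranking := isVertexRanking_of_colorings (R := R) (T := T) hℓ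
    (fun v => hlam v (Finset.mem_univ v)) hc₁ hc₂ hι Finset.subset_union_left hreach subset_rfl
    (fun v w hw hne h => hconf v w hw hne (h.imp_right fun ⟨u, hu, huT, h⟩ =>
      ⟨u, hu, fun huO => huT (Finset.mem_union_right _ huO), h⟩))
  set K := 4 * d + 2 with hK
  set S := s ^ (2 * t + 1) with hS
  have hSpos : 1 ≤ S := Nat.one_le_pow _ _ hs
  have hZcard : Z.card ≤ 2 * d * S := by
    have h1 := hG.mul_card_degree_gt_le Finset.univ (s ^ 2)
    rw [Finset.card_univ] at h1
    refine Nat.le_of_mul_le_mul_left ?_ (show 0 < s ^ 2 by positivity)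
    calc s ^ 2 * Z.card ≤ 2 * d * Fintype.card V := by convert h1
      _ ≤ 2 * d * s ^ (2 * t + 3) := Nat.mul_le_mul_left _ hcard
      _ = s ^ 2 * (2 * d * S) := by rw [hS]; ring
  -- One factor `s` comes from the overload threshold, the other from the bound on the shadow.
  have hOcard : O.card ≤ 4 * d * K ^ (3 * ℓ) * S := by
    have h1 := mul_card_overloaded_le (Z := Z) (s := s) hup Y
    refine Nat.le_of_mul_le_mul_left ?_ (show 0 < s ^ 2 by positivity)
    calc s ^ 2 * O.card = s * (s * O.card) := by ring
      _ ≤ s * (4 * d * Y.card) := Nat.mul_le_mul_left _ h1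
      _ = 4 * d * (s * Y.card) := by ring
      _ ≤ 4 * d * (s ^ (2 * t + 3) * K ^ (3 * ℓ)) :=
        Nat.mul_le_mul_left _ (hshadow.trans (Nat.mul_le_mul_right _ hcard))
      _ = s ^ 2 * (4 * d * K ^ (3 * ℓ) * S) := by rw [hS]; ring
  have hTcard : T.card ≤ 2 * d * S + 4 * d * K ^ (3 * ℓ) * S :=
    (Finset.card_union_le _ _).trans (Nat.add_le_add hZcard hOcard)
  have hK₁ : 1 ≤ K ^ ℓ := Nat.one_le_pow _ _ (by omega)
  have hKK : K ^ ℓ ≤ K ^ (2 * ℓ) := Nat.pow_le_pow_right (by omega) (by omega)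
  have hk₁ : 2 * K ^ ℓ + S ≤ 3 * K ^ ℓ * S := by nlinarith
  have hk₂ : 2 * (K ^ ℓ + K ^ (2 * ℓ) * S) + 1 ≤ 5 * K ^ (2 * ℓ) * S := by nlinarith
  have hmk₁ := Nat.mul_le_mul_left m hk₁
  have htop : m * (2 * K ^ ℓ + S) + (2 * (K ^ ℓ + K ^ (2 * ℓ) * S) + 1) + T.card ≤
      (3 * K ^ ℓ + 5 * K ^ (2 * ℓ) + 2 * d + 4 * d * K ^ (3 * ℓ)) * (m + 1) * S := by
    calc _ ≤ m * (3 * K ^ ℓ * S) + 5 * K ^ (2 * ℓ) * S +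
        (2 * d * S + 4 * d * K ^ (3 * ℓ) * S) := by omega
      -- Padding by nonnegative terms makes `m + 1` a common factor.
      _ ≤ m * (3 * K ^ ℓ * S) + 5 * K ^ (2 * ℓ) * S + (2 * d * S + 4 * d * K ^ (3 * ℓ) * S) +
        (m * (5 * K ^ (2 * ℓ) * S) + m * (2 * d * S + 4 * d * K ^ (3 * ℓ) * S) +
          3 * K ^ ℓ * S) := Nat.le_add_right _ _
      _ = _ := by ring
  refine vertexRankingNumber_le_of_isVertexRanking (fun v => lt_of_lt_of_le ?_ htop) hranking
  have h1 := hc₁ v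
  have h2 := hc₂ v
  have h3 := Nat.mul_le_mul_right (2 * K ^ ℓ + S) (hlam v (Finset.mem_univ v))
  rw [Nat.succ_mul] at h3
  split_ifs with hvT hvR
  · have := hιT v hvT
    omega
  · omega
  · omega

theorem IsDegenerate.vertexRankingNumber_le_rpow [Fintype V] {G : SimpleGraph V} {d ℓ t : ℕ}
    (hd : 1 ≤ d) (hG : G.IsDegenerate d) (hℓ : ℓ ≤ 2 * t + 3) (hn : 2 ≤ Fintype.card V) :
    (G.vertexRankingNumber ℓ : ℝ) ≤
      ((3 * (4 * d + 2) ^ ℓ + 5 * (4 * d + 2) ^ (2 * ℓ) + 2 * d +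
        4 * d * (4 * d + 2) ^ (3 * ℓ) : ℕ) : ℝ) * 6 * 2 ^ (2 * t + 1) *
      (Fintype.card V : ℝ) ^ (((2 * t + 1 : ℕ) : ℝ) / ((2 * t + 3 : ℕ) : ℝ)) *
        Real.log (Fintype.card V) := by
  set n := Fintype.card V with hn'
  have hn0 : (0 : ℝ) ≤ n := Nat.cast_nonneg _
  have hn1 : (1 : ℝ) ≤ n := by exact_mod_cast (by omega : 1 ≤ n)
  set x : ℝ := (n : ℝ) ^ (1 / ((2 * t + 3 : ℕ) : ℝ)) with hx
  have hx1 : 1 ≤ x := Real.one_le_rpow hn1 (by positivity)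
  have hxpow : x ^ (2 * t + 3) = n := by
    rw [hx, one_div]
    exact Real.rpow_inv_natCast_pow hn0 (by omega)
  have hs1 : 1 ≤ ⌈x⌉₊ := Nat.one_le_ceil_iff.mpr (by linarith)
  have hs2 : (⌈x⌉₊ : ℝ) ≤ 2 * x := by
    have := Nat.ceil_lt_add_one (show 0 ≤ x by linarith)
    linarith
  have hcard : n ≤ ⌈x⌉₊ ^ (2 * t + 3) := by
    have : (n : ℝ) ≤ (⌈x⌉₊ : ℝ) ^ (2 * t + 3) := by
      rw [← hxpow]
      exact pow_le_pow_left₀ (by linarith) (Nat.le_ceil x) _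
    exact_mod_cast this
  have hmain := hG.vertexRankingNumber_le hd hℓ hs1 hcard
    (Nat.lt_pow_succ_log_self one_lt_two n)
  -- As `n ≥ 2`, the left side is at most `3 * Real.log n / Real.log 2`, and `Real.log 2 > 1 / 2`.
  have hlog : ((Nat.log 2 n + 1 + 1 : ℕ) : ℝ) ≤ 6 * Real.log n := by
    have h1 : (2 : ℝ) ^ Nat.log 2 n ≤ n := by
      exact_mod_cast Nat.pow_log_le_self 2 (by omega)
    have h2 := Real.log_le_log (by positivity) h1
    rw [Real.log_pow] at h2
    have h3 := Real.log_two_gt_d9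
    have h4 : Real.log 2 ≤ Real.log n :=
      Real.log_le_log (by norm_num) (by exact_mod_cast hn)
    have h5 : (0 : ℝ) ≤ Nat.log 2 n := Nat.cast_nonneg _
    push_cast
    nlinarith
  have hspow : (⌈x⌉₊ : ℝ) ^ (2 * t + 1) ≤ 2 ^ (2 * t + 1) *
      (n : ℝ) ^ (((2 * t + 1 : ℕ) : ℝ) / ((2 * t + 3 : ℕ) : ℝ)) := by
    have h1 : (n : ℝ) ^ (((2 * t + 1 : ℕ) : ℝ) / ((2 * t + 3 : ℕ) : ℝ)) = x ^ (2 * t + 1) := by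
      rw [hx, ← Real.rpow_natCast, ← Real.rpow_mul hn0]
      congr 1
      ring
    rw [h1, ← mul_pow]
    exact pow_le_pow_left₀ (Nat.cast_nonneg _) hs2 _
  set C := 3 * (4 * d + 2) ^ ℓ + 5 * (4 * d + 2) ^ (2 * ℓ) + 2 * d +
    4 * d * (4 * d + 2) ^ (3 * ℓ) with hC
  have hmain' : (G.vertexRankingNumber ℓ : ℝ) ≤
      (C : ℝ) * ((Nat.log 2 n + 1 + 1 : ℕ) : ℝ) * (⌈x⌉₊ : ℝ) ^ (2 * t + 1) := by
    exact_mod_cast hmain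
  refine hmain'.trans ?_
  have hlog0 : 0 ≤ Real.log n := Real.log_nonneg hn1
  calc _ ≤ (C : ℝ) * (6 * Real.log n) * (2 ^ (2 * t + 1) *
      (n : ℝ) ^ (((2 * t + 1 : ℕ) : ℝ) / ((2 * t + 3 : ℕ) : ℝ))) := by gcongr
    _ = _ := by ring

end SimpleGraph

theorem theorem2 (d ℓ : ℕ) (hd : 1 ≤ d) (hℓ : 2 ≤ ℓ) :
    ∃ c : ℝ, ∀ n : ℕ, 2 ≤ n → ∀ (V : Type*) [Fintype V] (G : SimpleGraph V),
      Fintype.card V = n → G.IsDegenerate d →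
        (G.vertexRankingNumber ℓ : ℝ)
            ≤ c * (n : ℝ) ^ (1 - 1 / (((ℓ / 2 : ℕ) : ℝ) + 1 / 2)) * Real.log n ∧
        (Odd ℓ → (G.vertexRankingNumber ℓ : ℝ)
            ≤ c * (n : ℝ) ^ (1 - 2 / (ℓ : ℝ)) * Real.log n) ∧
        (Even ℓ → (G.vertexRankingNumber ℓ : ℝ)
            ≤ c * (n : ℝ) ^ (1 - 2 / ((ℓ : ℝ) + 1)) * Real.log n) := by
  -- Thus `ℓ` is `2 * t + 2` or `2 * t + 3`, and both parities share the exponent `(2t+1)/(2t+3)`.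
  obtain ⟨t, ht⟩ : ∃ t, ℓ / 2 = t + 1 := ⟨ℓ / 2 - 1, by omega⟩
  refine ⟨((3 * (4 * d + 2) ^ ℓ + 5 * (4 * d + 2) ^ (2 * ℓ) + 2 * d +
    4 * d * (4 * d + 2) ^ (3 * ℓ) : ℕ) : ℝ) * 6 * 2 ^ (2 * t + 1), ?_⟩
  intro n hn V _ G hcard hG
  have hmain := hG.vertexRankingNumber_le_rpow (ℓ := ℓ) (t := t) hd (by omega)
    (by rw [hcard]; exact hn)
  rw [hcard] at hmain
  have hexp : ((2 * t + 1 : ℕ) : ℝ) / ((2 * t + 3 : ℕ) : ℝ) = 1 - 2 / (2 * (t : ℝ) + 3) := by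
    push_cast
    field_simp
    ring
  rw [hexp] at hmain
  refine ⟨?_, fun hodd => ?_, fun heven => ?_⟩
  · have h : 1 / (((ℓ / 2 : ℕ) : ℝ) + 1 / 2) = 2 / (2 * (t : ℝ) + 3) := by
      rw [ht, div_eq_div_iff (by positivity) (by positivity)]
      push_cast
      ring
    rw [h]
    exact hmain
  · obtain ⟨k, hk⟩ := hodd
    have h : (ℓ : ℝ) = 2 * t + 3 := by exact_mod_cast (by omega : ℓ = 2 * t + 3)
    rw [h]
    exact hmain
  · obtain ⟨k, hk⟩ := heven
    have h : (ℓ : ℝ) + 1 = 2 * t + 3 := by exact_mod_cast (by omega : ℓ + 1 = 2 * t + 3)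
    rw [h]
    exact hmain
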